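/- Let $\mathcal H$ be a Hilbert space of finite dimension $d\ge 1$. A POVM on $\mathcal H$ is a finite family $\mathscr A=\{A_j\}_j$ of positive semidefinite operators with $\sum_j A_j=1$. It is rank-1 if every $A_j$ has rank one (in particular is nonzero), and simple if its elements are pairwise linearly independent. A rank-1 projective measurement is a POVM whose elements are mutually orthogonal rank-1 projectors. A SIC is a POVM with exactly $d^2$ elements $A_j=\frac1d|\psi_j\rangle\langle\psi_j|$ with $|\langle\psi_j|\psi_k\rangle|^2=\frac{d\,\delta_{jk}+1}{d+1}$ for all $j,k$. For a POVM $\mathscr M=\{M_j\}_j$ on $\mathcal H^{\otimes N}$, the estimation fidelity $F(\mathscr M)$ is the maximum, over all choices of density operators $\hat\rho_j$ on $\mathcal H$ (one for each outcome), of the average fidelity $$\sum_j\int \operatorname{tr}\bigl(\rho^{\otimes N}M_j\bigr)\,\operatorname{tr}(\rho\hat\rho_j)\,d\mu(\psi),\qquad \rho=|\psi\rangle\langle\psi|,$$ where $\mu$ is the normalized measure on pure states induced by the Haar measure on the unitary group. Let $\mathscr A^{\otimes 2}=\{A_j\otimes A_k\}_{j,k}$, a POVM on $\mathcal H^{\otimes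 2}$. **Theorem.** Let $\mathscr A$ be any rank-1 POVM on $\mathcal H$. Then the two-copy estimation fidelity satisfies $$\frac{2}{d+1}\le F(\mathscr A^{\otimes 2})\le F_2^{\mathrm{iid}},\qquad F_2^{\mathrm{iid}}:=\frac{2\bigl[d^2+d+1+(d-1)\sqrt{d+1}\,\bigr]}{d(d+1)(d+2)}.$$ If $\mathscr A$ is moreover simple, then $F(\mathscr A^{\otimes 2})=\frac{2}{d+1}$ if and only if $\mathscr A$ is a rank-1 projective measurement, and $F(\mathscr A^{\otimes 2})=F_2^{\mathrm{iid}}$ if and only if $\mathscr A$ is a SIC. -/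

import Mathlib

open Matrix
open scoped ComplexOrder

noncomputable section

namespace QMeas

/-! ### Measurements (POVMs) with finitely many outcomes, in coordinates -/

/-- A POVM on the Hilbert space `ℂ^n`, with outcomes labelled by `κ`: positive semidefinite
operators that sum up to the identity. -/
def IsPOVM {n κ : Type*} [Fintype n] [DecidableEq n] [Fintype κ] (A : κ → Matrix n n ℂ) : Prop :=
  (∀ j, (A j).PosSemidef) ∧ ∑ j, A j = 1

/-- Every element of the POVM has rank one (in particular it is nonzero). For positive
semidefinite operators this says: a positive multiple of a rank-one projector. -/
def IsRankOne {n κ : Type*} [Fintype n] (A : κ → Matrix n n ℂ) : Prop :=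
  ∀ j, (A j).rank = 1

/-- A simple POVM: the elements are pairwise linearly independent. -/
def IsSimple {n κ : Type*} (A : κ → Matrix n n ℂ) : Prop :=
  ∀ j k, j ≠ k → LinearIndependent ℂ ![A j, A k]

/-- A rank-one projective measurement: the elements are mutually orthogonal rank-one
(orthogonal, i.e. self-adjoint) projectors. -/
def IsRankOneProjective {n κ : Type*} [Fintype n] (A : κ → Matrix n n ℂ) : Prop :=
  (∀ j, IsStarProjection (A j) ∧ (A j).rank = 1) ∧ ∀ j k, j ≠ k → A j * A k = 0

open Classical in
/-- A SIC in dimension `d`: the POVM elements are `|ψ_j⟩⟨ψ_j| / d` for `d ^ 2` unit vectors `ψ_j`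
with `|⟨ψ_j|ψ_k⟩|² = (d δ_{jk} + 1) / (d + 1)`. -/
def IsSIC {d : ℕ} {κ : Type*} [Fintype κ] (A : κ → Matrix (Fin d) (Fin d) ℂ) : Prop :=
  Fintype.card κ = d ^ 2 ∧
    ∃ ψ : κ → Fin d → ℂ,
      (∀ j k, ‖star (ψ j) ⬝ᵥ ψ k‖ ^ 2
        = ((d : ℝ) * (if j = k then 1 else 0) + 1) / ((d : ℝ) + 1)) ∧
      ∀ j, A j = ((d : ℂ)⁻¹) • vecMulVec (ψ j) (star (ψ j))

/-! ### Tensor products -/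

/-- The operator `M 0 ⊗ ⋯ ⊗ M (N - 1)` on `(ℂ^d)^{⊗ N}`, whose standard basis is indexed by
`Fin N → Fin d`. -/
def tensorOp {d N : ℕ} (M : Fin N → Matrix (Fin d) (Fin d) ℂ) :
    Matrix (Fin N → Fin d) (Fin N → Fin d) ℂ :=
  Matrix.of fun a b => ∏ i, M i (a i) (b i)

/-- The product measurement `A ⊗ A` on two copies: its elements are `A j ⊗ A k`. -/
def twoCopy {d : ℕ} {κ : Type*} (A : κ → Matrix (Fin d) (Fin d) ℂ) :
    κ × κ → Matrix (Fin 2 → Fin d) (Fin 2 → Fin d) ℂ :=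
  fun jk => tensorOp ![A jk.1, A jk.2]

/-! ### Haar-random pure states -/

instance instMeasurableSpaceUnitaryGroup (d : ℕ) : MeasurableSpace (unitaryGroup (Fin d) ℂ) :=
  borel _

instance instBorelSpaceUnitaryGroup (d : ℕ) : BorelSpace (unitaryGroup (Fin d) ℂ) := ⟨rfl⟩

instance instCompactSpaceUnitaryGroup (d : ℕ) : CompactSpace (unitaryGroup (Fin d) ℂ) := by
  have hK : IsCompact (Set.univ.pi fun _ : Fin d => Set.univ.pi fun _ : Fin d =>
      Metric.closedBall (0 : ℂ) 1) :=
    isCompact_univ_pi fun _ => isCompact_univ_pi fun _ => isCompact_closedBall 0 1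
  have hc : IsCompact ((unitaryGroup (Fin d) ℂ : Submonoid (Matrix (Fin d) (Fin d) ℂ)) :
      Set (Matrix (Fin d) (Fin d) ℂ)) := by
    refine IsCompact.of_isClosed_subset hK isClosed_unitary ?_
    intro U hU i _ j _
    simpa using entry_norm_bound_of_unitary hU i j
  exact isCompact_iff_compactSpace.mp hc

/-- The normalized Haar measure on the unitary group `U(d)`. -/
def haarUnitary (d : ℕ) : MeasureTheory.Measure (unitaryGroup (Fin d) ℂ) :=
  MeasureTheory.Measure.haarMeasure ⊤

/-- The pure state `|ψ⟩⟨ψ|` with `|ψ⟩ = U |0⟩`. If `U` is distributed according to the normalized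
Haar measure, this is a Haar-random pure state. -/
def pureState {d : ℕ} [NeZero d] (U : unitaryGroup (Fin d) ℂ) : Matrix (Fin d) (Fin d) ℂ :=
  (U : Matrix (Fin d) (Fin d) ℂ) * Matrix.single 0 0 1 * star (U : Matrix (Fin d) (Fin d) ℂ)

/-! ### Estimation fidelity -/

/-- Density operators: positive semidefinite of trace one. -/
def IsDensity {n : Type*} [Fintype n] (ρ : Matrix n n ℂ) : Prop :=
  ρ.PosSemidef ∧ ρ.trace = 1

/-- The average fidelity `∑_j ∫ tr(ρ^{⊗ N} A_j) tr(ρ σ_j) dμ(ρ)` of estimating a Haar-random pure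
state `ρ`, given `N` copies of it, when the POVM `A` is performed on `ρ^{⊗ N}` and `σ j` is the
estimator used for outcome `j`. (Both traces are real.) -/
def averageFidelity {d N : ℕ} [NeZero d] {κ : Type*} [Fintype κ]
    (A : κ → Matrix (Fin N → Fin d) (Fin N → Fin d) ℂ)
    (σ : κ → Matrix (Fin d) (Fin d) ℂ) : ℝ :=
  ∑ j, ∫ U, (tensorOp (fun _ : Fin N => pureState U) * A j).trace.re
    * (pureState U * σ j).trace.re ∂(haarUnitary d)

/-- The estimation fidelity of a POVM on `(ℂ^d)^{⊗ N}`: the largest average fidelity that is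
achieved by a choice of estimators. -/
def estimationFidelity {d N : ℕ} [NeZero d] {κ : Type*} [Fintype κ]
    (A : κ → Matrix (Fin N → Fin d) (Fin N → Fin d) ℂ) : ℝ :=
  sSup {x : ℝ | ∃ σ : κ → Matrix (Fin d) (Fin d) ℂ,
    (∀ j, IsDensity (σ j)) ∧ x = averageFidelity A σ}

/-- `2 [d² + d + 1 + (d - 1) √(d + 1)] / (d (d + 1) (d + 2))`. -/
def F2iid (d : ℕ) : ℝ :=
  2 * ((d : ℝ) ^ 2 + d + 1 + ((d : ℝ) - 1) * Real.sqrt ((d : ℝ) + 1))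
    / ((d : ℝ) * ((d : ℝ) + 1) * ((d : ℝ) + 2))

end QMeas

end

namespace QMeas

open MeasureTheory Complex

/-! ### Polarization identities for fourth and sixth powers of the norm. -/

section Polarization

variable {E : Type*} [NormedAddCommGroup E] [InnerProductSpace ℂ E]

/-! Write `A j = a j |v j⟩⟨v j|` with unit vectors, and let `s` be the overlap of a pair. The third
Haar moment `haarMean_overlap_mul` is the permanent of the Gram matrix of `u, v, x`, divided by
`d(d+1)(d+2)`. For a pair of outcomes the best estimator is a top eigenvector of `(|u⟩⟨u| +
|v⟩⟨v|)²`, with eigenvalue `(1+s)²`, so the pair contributes a multiple of `1 + s + s²`. The POVM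
condition fixes `∑ a a = d²` and `∑ a a s² = d`; hence the fidelity is an increasing affine function
of `S = ∑ a a s` (`estimationFidelity_eq`).

Below, `s² ≤ s` gives `S ≥ d`. Equality forces `s ∈ {0, 1}`; simplicity excludes `1` off the
diagonal, leaving orthogonality.

Above, put `t = 1/√(d+1)`, the overlap of a SIC. The quartic `(s-t)²(1-s)(s+1+2t)` is nonnegative on
`[0,1]` and has no cubic term. Summing it against the weights bounds `S` through the moments of
order 0 and 2 and the frame potential `∑ a a s⁴ ≥ 2d/(d+1)`, which is Cauchy–Schwarz against the
symmetric projector. Equality forces `s ∈ {t, 1}`, hence `s = t` off the diagonal, and the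
resolution of the identity then forces equal weights and `d²` outcomes. -/

theorem norm_add_smul_sq (u v : E) (z : ℂ) :
    ‖u + z • v‖ ^ 2 = ‖u‖ ^ 2 + ‖z‖ ^ 2 * ‖v‖ ^ 2
      + 2 * (z.re * (inner ℂ u v).re - z.im * (inner ℂ u v).im) := by
  rw [norm_add_sq (𝕜 := ℂ), inner_smul_right, norm_smul, mul_pow]
  simp only [RCLike.re_to_complex, Complex.mul_re]
  ring

theorem norm_inner_add_smul_sq (u v w : E) (z : ℂ) :
    ‖inner ℂ w (u + z • v)‖ ^ 2 = ‖inner ℂ w u‖ ^ 2 + ‖z‖ ^ 2 * ‖inner ℂ w v‖ ^ 2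
      + 2 * (z.re * (inner ℂ u w * inner ℂ w v).re - z.im * (inner ℂ u w * inner ℂ w v).im) := by
  rw [inner_add_right, inner_smul_right, ← smul_eq_mul, norm_add_smul_sq]
  have : inner ℂ (inner ℂ w u) (inner ℂ w v) = inner ℂ u w * inner ℂ w v := by
    rw [RCLike.inner_apply, inner_conj_symm, mul_comm]
  rw [this]

theorem norm_sq_eq_re_im (z : ℂ) : ‖z‖ ^ 2 = z.re ^ 2 + z.im ^ 2 := by
  rw [← Complex.normSq_eq_norm_sq, Complex.normSq_apply]; ring

/-- The fourth powers of the norm, summed over the fourth roots of unity. -/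
theorem sum_norm_pow_four (u v : E) :
    ‖u + (1 : ℂ) • v‖ ^ 4 + ‖u + (-1 : ℂ) • v‖ ^ 4 + ‖u + I • v‖ ^ 4 + ‖u + (-I) • v‖ ^ 4
      = 4 * ((‖u‖ ^ 2 + ‖v‖ ^ 2) ^ 2 + 2 * ‖inner ℂ u v‖ ^ 2) := by
  have h (x : E) : ‖x‖ ^ 4 = (‖x‖ ^ 2) ^ 2 := by ring
  simp only [h, norm_add_smul_sq, norm_sq_eq_re_im (inner ℂ u v)]
  simp
  ring

theorem sum_norm_pow_six (u v : E) (t : ℝ) :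
    ‖u + (t : ℂ) • v‖ ^ 6 + ‖u + (-t : ℂ) • v‖ ^ 6 + ‖u + (t * I) • v‖ ^ 6
        + ‖u + (-(t * I)) • v‖ ^ 6
      = 4 * ((‖u‖ ^ 2 + t ^ 2 * ‖v‖ ^ 2) ^ 3
        + 6 * t ^ 2 * (‖u‖ ^ 2 + t ^ 2 * ‖v‖ ^ 2) * ‖inner ℂ u v‖ ^ 2) := by
  have h (x : E) : ‖x‖ ^ 6 = (‖x‖ ^ 2) ^ 3 := by ring
  simp only [h, norm_add_smul_sq, norm_sq_eq_re_im (inner ℂ u v)]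
  simp
  ring

theorem sum_norm_sq_mul_norm_inner_sq (u v w : E) :
    ‖u + (1 : ℂ) • v‖ ^ 2 * ‖inner ℂ w (u + (1 : ℂ) • v)‖ ^ 2
        + ‖u + (-1 : ℂ) • v‖ ^ 2 * ‖inner ℂ w (u + (-1 : ℂ) • v)‖ ^ 2
        + ‖u + I • v‖ ^ 2 * ‖inner ℂ w (u + I • v)‖ ^ 2
        + ‖u + (-I) • v‖ ^ 2 * ‖inner ℂ w (u + (-I) • v)‖ ^ 2
      = 4 * ((‖u‖ ^ 2 + ‖v‖ ^ 2) * (‖inner ℂ w u‖ ^ 2 + ‖inner ℂ w v‖ ^ 2)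
        + 2 * (inner ℂ u w * inner ℂ w v * inner ℂ v u).re) := by
  have h : inner ℂ v u = (starRingEnd ℂ) (inner ℂ u v) := (inner_conj_symm _ _).symm
  rw [Complex.mul_re _ (inner ℂ v u), h, Complex.conj_re, Complex.conj_im]
  simp only [norm_add_smul_sq, norm_inner_add_smul_sq]
  simp [-Complex.mul_re, -Complex.mul_im]
  ring

/-- Polarization of a sextic form: the value at `(u, u, v)`. -/
theorem polarization_six (u v : E) :
    16 * (‖u + ((1 : ℝ) : ℂ) • v‖ ^ 6 + ‖u + (-(1 : ℝ) : ℂ) • v‖ ^ 6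
        + ‖u + ((1 : ℝ) * I) • v‖ ^ 6 + ‖u + (-((1 : ℝ) * I)) • v‖ ^ 6)
      - (‖u + ((2 : ℝ) : ℂ) • v‖ ^ 6 + ‖u + (-(2 : ℝ) : ℂ) • v‖ ^ 6
        + ‖u + ((2 : ℝ) * I) • v‖ ^ 6 + ‖u + (-((2 : ℝ) * I)) • v‖ ^ 6)
      - 60 * ‖u‖ ^ 6 + 192 * ‖v‖ ^ 6
      = 144 * ‖u‖ ^ 2 * (‖u‖ ^ 2 * ‖v‖ ^ 2 + 2 * ‖inner ℂ u v‖ ^ 2) := by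
  rw [sum_norm_pow_six, sum_norm_pow_six]
  ring

end Polarization

/-! ### Third moments of Haar-random pure states. -/

section Haar

variable {d : ℕ} [NeZero d]

instance instIsProbabilityMeasureHaarUnitary (d : ℕ) : IsProbabilityMeasure (haarUnitary d) := by
  refine ⟨?_⟩
  have := Measure.haarMeasure_self (G := unitaryGroup (Fin d) ℂ) (K₀ := ⊤)
  simpa [haarUnitary] using this

instance instIsMulLeftInvariantHaarUnitary (d : ℕ) : (haarUnitary d).IsMulLeftInvariant := by
  unfold haarUnitary; infer_instance

/-- The state vector `U |0⟩`. -/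
noncomputable def stateVec (U : unitaryGroup (Fin d) ℂ) : EuclideanSpace ℂ (Fin d) :=
  WithLp.toLp 2 fun a => (U : Matrix (Fin d) (Fin d) ℂ) a 0

theorem continuous_stateVec : Continuous (stateVec (d := d)) := by
  unfold stateVec
  refine (PiLp.continuous_toLp 2 _).comp (continuous_pi fun a => ?_)
  exact (continuous_apply_apply a 0).comp continuous_subtype_val

theorem pureState_eq (U : unitaryGroup (Fin d) ℂ) :
    pureState U = vecMulVec (stateVec U) (star (stateVec U).ofLp) := by
  ext a b
  simp [pureState, stateVec, vecMulVec_apply, Matrix.mul_apply, Matrix.single_apply,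
    Finset.sum_ite_eq, ite_and]

theorem trace_pureState_mul_vecMulVec (U : unitaryGroup (Fin d) ℂ)
    (x : EuclideanSpace ℂ (Fin d)) :
    (pureState U * vecMulVec x.ofLp (star x.ofLp)).trace
      = ((‖inner ℂ (stateVec U) x‖ ^ 2 : ℝ) : ℂ) := by
  rw [pureState_eq, vecMulVec_mul_vecMulVec, trace_vecMulVec, dotProduct_smul]
  have h1 : star (stateVec U).ofLp ⬝ᵥ x.ofLp = inner ℂ (stateVec U) x := by
    rw [EuclideanSpace.inner_eq_star_dotProduct, dotProduct_comm]
  have h2 : (stateVec U).ofLp ⬝ᵥ star x.ofLp = inner ℂ x (stateVec U) := by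
    rw [EuclideanSpace.inner_eq_star_dotProduct]
  rw [h1, h2, smul_eq_mul, ← inner_conj_symm x, Complex.mul_conj, Complex.normSq_eq_norm_sq]

theorem norm_stateVec (U : unitaryGroup (Fin d) ℂ) : ‖stateVec U‖ = 1 := by
  have h := congrFun (congrFun (mem_unitaryGroup_iff'.mp U.2) 0) 0
  rw [Matrix.mul_apply] at h
  have h2 : ‖stateVec U‖ ^ 2 = 1 := by
    rw [EuclideanSpace.norm_sq_eq]
    have h3 : ((∑ i, ‖(stateVec U) i‖ ^ 2 : ℝ) : ℂ) = 1 := by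
      simpa [stateVec, Matrix.star_apply, ← Complex.normSq_eq_conj_mul_self,
        Complex.normSq_eq_norm_sq] using h
    exact_mod_cast h3
  nlinarith [norm_nonneg (stateVec U)]

/-- A unitary matrix that maps the first basis vector to a given unit vector. -/
theorem exists_stateVec_eq (x : EuclideanSpace ℂ (Fin d)) (hx : ‖x‖ = 1) :
    ∃ U : unitaryGroup (Fin d) ℂ, stateVec U = x := by
  obtain ⟨b, hb⟩ := Orthonormal.exists_orthonormalBasis_extension_of_card_eq (𝕜 := ℂ)
    (E := EuclideanSpace ℂ (Fin d)) (ι := Fin d) (by simp) (v := fun _ => x) (s := {0}) (by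
      refine ⟨fun _ => hx, fun i j hij => (hij (Subsingleton.elim _ _)).elim⟩)
  refine ⟨⟨(EuclideanSpace.basisFun (Fin d) ℂ).toBasis.toMatrix b,
    (EuclideanSpace.basisFun (Fin d) ℂ).toMatrix_orthonormalBasis_mem_unitary b⟩, ?_⟩
  ext a
  simp [stateVec, Module.Basis.toMatrix_apply, hb 0 (by simp)]

theorem inner_stateVec_mul (V U : unitaryGroup (Fin d) ℂ) :
    inner ℂ (stateVec (V * U)) (stateVec V)
      = inner ℂ (stateVec U) (stateVec (1 : unitaryGroup (Fin d) ℂ)) := by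
  have h : ∀ W : unitaryGroup (Fin d) ℂ, inner ℂ (stateVec W) (stateVec V)
      = (star (W : Matrix (Fin d) (Fin d) ℂ) * (V : Matrix (Fin d) (Fin d) ℂ)) 0 0 := by
    intro W
    simp [stateVec, EuclideanSpace.inner_eq_star_dotProduct, Matrix.mul_apply, dotProduct,
      Matrix.star_apply, mul_comm]
  rw [h]
  have h2 : star ((V * U : unitaryGroup (Fin d) ℂ) : Matrix (Fin d) (Fin d) ℂ)
      * (V : Matrix (Fin d) (Fin d) ℂ) = star (U : Matrix (Fin d) (Fin d) ℂ) := by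
    rw [Submonoid.coe_mul, star_mul, mul_assoc, Unitary.star_mul_self_of_mem V.2, mul_one]
  rw [h2]
  simp [stateVec, EuclideanSpace.inner_eq_star_dotProduct, dotProduct, Matrix.one_apply,
    Matrix.star_apply]

/-- The overlap `|⟨ψ|x⟩|²` as a continuous function of the unitary that prepares `ψ`. -/
noncomputable def overlap (x : EuclideanSpace ℂ (Fin d)) : C(unitaryGroup (Fin d) ℂ, ℝ) where
  toFun U := ‖inner ℂ (stateVec U) x‖ ^ 2
  continuous_toFun := ((continuous_stateVec.inner continuous_const).norm).pow 2

theorem overlap_apply (x : EuclideanSpace ℂ (Fin d)) (U : unitaryGroup (Fin d) ℂ) :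
    overlap x U = ‖inner ℂ (stateVec U) x‖ ^ 2 := rfl

omit [NeZero d] in
theorem integrable_continuousMap (f : C(unitaryGroup (Fin d) ℂ, ℝ)) :
    Integrable f (haarUnitary d) :=
  f.continuous.integrable_of_hasCompactSupport (HasCompactSupport.of_compactSpace _)

/-- The Haar average as a linear functional on continuous functions. -/
noncomputable def haarMean (d : ℕ) [NeZero d] : C(unitaryGroup (Fin d) ℂ, ℝ) →ₗ[ℝ] ℝ where
  toFun f := ∫ U, f U ∂(haarUnitary d)
  map_add' f g := integral_add (integrable_continuousMap f) (integrable_continuousMap g)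
  map_smul' c f := integral_const_mul c f

theorem haarMean_apply (f : C(unitaryGroup (Fin d) ℂ, ℝ)) :
    haarMean d f = ∫ U, f U ∂(haarUnitary d) := rfl

theorem overlap_smul (c : ℂ) (x : EuclideanSpace ℂ (Fin d)) :
    overlap (c • x) = ‖c‖ ^ 2 • overlap x := by
  ext U
  simp [overlap_apply, mul_pow]

theorem sum_overlap_basis :
    ∑ a, overlap (EuclideanSpace.basisFun (Fin d) ℂ a) = 1 := by
  ext U
  have := (EuclideanSpace.basisFun (Fin d) ℂ).sum_sq_norm_inner_left (stateVec U)
  rw [norm_stateVec] at this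
  simpa [overlap_apply, norm_inner_symm] using this

/-- `𝔼 |⟨ψ|0⟩|⁶`. -/
noncomputable def sixthMoment (d : ℕ) [NeZero d] : ℝ :=
  haarMean d (overlap (stateVec 1) ^ 3)

/-- The unitary group is transitive on the unit sphere and Haar measure is left invariant, so only
the norm of `x` matters. Polarizing this one identity yields all third moments. -/
theorem haarMean_overlap_pow_three (x : EuclideanSpace ℂ (Fin d)) :
    haarMean d (overlap x ^ 3) = sixthMoment d * ‖x‖ ^ 6 := by
  by_cases hx : x = 0
  · subst hx
    have : overlap (0 : EuclideanSpace ℂ (Fin d)) ^ 3 = 0 := by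
      ext U; simp [overlap_apply]
    simp [this]
  obtain ⟨V, hV⟩ := exists_stateVec_eq (((‖x‖⁻¹ : ℝ) : ℂ) • x) (by
    rw [norm_smul, Complex.norm_real, norm_inv, norm_norm, inv_mul_cancel₀ (by simpa using hx)])
  have hx' : x = ((‖x‖ : ℝ) : ℂ) • stateVec V := by
    rw [hV, smul_smul, ← Complex.ofReal_mul, mul_inv_cancel₀ (by simpa using hx)]; simp
  have h1 : haarMean d (overlap (stateVec V) ^ 3) = sixthMoment d := by
    rw [sixthMoment, haarMean_apply, haarMean_apply, ← integral_mul_left_eq_self _ V]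
    simp only [ContinuousMap.pow_apply, overlap_apply, inner_stateVec_mul]
  conv_lhs => rw [hx']
  rw [overlap_smul, smul_pow, map_smul, h1, Complex.norm_real, norm_norm, smul_eq_mul]
  ring

theorem haarMean_overlap_sq_mul (u v : EuclideanSpace ℂ (Fin d)) :
    haarMean d (overlap u ^ 2 * overlap v)
      = sixthMoment d / 3 * ‖u‖ ^ 2 * (‖u‖ ^ 2 * ‖v‖ ^ 2 + 2 * ‖inner ℂ u v‖ ^ 2) := by
  have key : (432 : ℝ) • (overlap u ^ 2 * overlap v)
      = (16 : ℝ) • (overlap (u + ((1 : ℝ) : ℂ) • v) ^ 3 + overlap (u + (-(1 : ℝ) : ℂ) • v) ^ 3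
          + overlap (u + ((1 : ℝ) * I) • v) ^ 3 + overlap (u + (-((1 : ℝ) * I)) • v) ^ 3)
        - (overlap (u + ((2 : ℝ) : ℂ) • v) ^ 3 + overlap (u + (-(2 : ℝ) : ℂ) • v) ^ 3
          + overlap (u + ((2 : ℝ) * I) • v) ^ 3 + overlap (u + (-((2 : ℝ) * I)) • v) ^ 3)
        - (60 : ℝ) • overlap u ^ 3 + (192 : ℝ) • overlap v ^ 3 := by
    ext U
    have h := polarization_six (inner ℂ (stateVec U) u) (inner ℂ (stateVec U) v)
    simp only [ContinuousMap.add_apply, ContinuousMap.sub_apply, ContinuousMap.smul_apply,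
      ContinuousMap.mul_apply, ContinuousMap.pow_apply, overlap_apply, inner_add_right,
      inner_smul_right, smul_eq_mul, ← pow_mul] at h ⊢
    rw [h, RCLike.inner_apply, norm_mul, RCLike.norm_conj]
    ring
  have := congrArg (haarMean d) key
  simp only [map_add, map_sub, map_smul, smul_eq_mul, haarMean_overlap_pow_three] at this
  linear_combination this / 432 + sixthMoment d / 432 * polarization_six u v

theorem haarMean_overlap_mul_aux (u v w : EuclideanSpace ℂ (Fin d)) :
    haarMean d (overlap u * overlap v * overlap w)
      = sixthMoment d / 6 * (‖u‖ ^ 2 * ‖v‖ ^ 2 * ‖w‖ ^ 2 + ‖inner ℂ u v‖ ^ 2 * ‖w‖ ^ 2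
        + ‖u‖ ^ 2 * ‖inner ℂ w v‖ ^ 2 + ‖v‖ ^ 2 * ‖inner ℂ w u‖ ^ 2
        + 2 * (inner ℂ u w * inner ℂ w v * inner ℂ v u).re) := by
  have key : (16 : ℝ) • (overlap u * overlap v * overlap w)
      = overlap (u + (1 : ℂ) • v) ^ 2 * overlap w + overlap (u + (-1 : ℂ) • v) ^ 2 * overlap w
        + overlap (u + I • v) ^ 2 * overlap w + overlap (u + (-I) • v) ^ 2 * overlap w
        - (4 : ℝ) • (overlap u ^ 2 * overlap w) - (4 : ℝ) • (overlap v ^ 2 * overlap w) := by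
    ext U
    have h := sum_norm_pow_four (inner ℂ (stateVec U) u) (inner ℂ (stateVec U) v)
    rw [RCLike.inner_apply, norm_mul, RCLike.norm_conj] at h
    simp only [ContinuousMap.add_apply, ContinuousMap.sub_apply, ContinuousMap.smul_apply,
      ContinuousMap.mul_apply, ContinuousMap.pow_apply, overlap_apply, inner_add_right,
      inner_smul_right, smul_eq_mul, ← pow_mul] at h ⊢
    linear_combination -(‖inner ℂ (stateVec U) w‖ ^ 2) * h
  have := congrArg (haarMean d) key
  have hs (x : EuclideanSpace ℂ (Fin d)) : ‖inner ℂ x w‖ = ‖inner ℂ w x‖ := norm_inner_symm _ _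
  simp only [map_add, map_sub, map_smul, smul_eq_mul, haarMean_overlap_sq_mul, hs] at this
  linear_combination this / 16
    + sixthMoment d / 48 * ‖w‖ ^ 2 * sum_norm_pow_four u v
    + sixthMoment d / 24 * sum_norm_sq_mul_norm_inner_sq u v w

/-- The overlaps with an orthonormal basis sum to 1. Integrating the cube of this sum and counting
coinciding indices gives `d³ + 3d² + 2d = d(d+1)(d+2)` times one sixth of the moment. -/
theorem sixthMoment_eq : sixthMoment d = 6 / (d * (d + 1) * (d + 2)) := by
  have h : haarMean d ((∑ a, overlap (EuclideanSpace.basisFun (Fin d) ℂ a))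
      * (∑ a, overlap (EuclideanSpace.basisFun (Fin d) ℂ a))
      * (∑ a, overlap (EuclideanSpace.basisFun (Fin d) ℂ a))) = 1 := by
    rw [sum_overlap_basis]
    simp [haarMean_apply]
  have hd : (d : ℝ) ≠ 0 := by exact_mod_cast NeZero.ne d
  rw [Finset.sum_mul_sum, Finset.sum_mul_sum] at h
  simp only [Finset.sum_mul, map_sum, haarMean_overlap_mul_aux] at h
  have h2 : ∀ i j : Fin d, inner ℂ (EuclideanSpace.basisFun (Fin d) ℂ i)
      (EuclideanSpace.basisFun (Fin d) ℂ j) = if i = j then (1 : ℂ) else 0 := fun i j =>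
    orthonormal_iff_ite.mp (EuclideanSpace.basisFun (Fin d) ℂ).orthonormal i j
  simp only [h2, OrthonormalBasis.norm_eq_one] at h
  rw [eq_div_iff (by positivity)]
  simp [Finset.sum_add_distrib, ← Finset.mul_sum, apply_ite norm, apply_ite Complex.re, ite_pow] at h
  linear_combination 6 * h

/-- The third moments of Haar-random pure states. -/
theorem haarMean_overlap_mul (u v w : EuclideanSpace ℂ (Fin d)) :
    haarMean d (overlap u * overlap v * overlap w)
      = 1 / (d * (d + 1) * (d + 2)) * (‖u‖ ^ 2 * ‖v‖ ^ 2 * ‖w‖ ^ 2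
        + ‖inner ℂ u v‖ ^ 2 * ‖w‖ ^ 2 + ‖u‖ ^ 2 * ‖inner ℂ w v‖ ^ 2 + ‖v‖ ^ 2 * ‖inner ℂ w u‖ ^ 2
        + 2 * (inner ℂ u w * inner ℂ w v * inner ℂ v u).re) := by
  rw [haarMean_overlap_mul_aux, sixthMoment_eq]
  ring

end Haar

/-! ### The optimal estimator for a pair of outcomes. -/

section PairBound

variable {E : Type*} [NormedAddCommGroup E] [InnerProductSpace ℂ E]

/-- The largest eigenvalue of `(|u⟩⟨u| + |v⟩⟨v|)²` is at most `(1 + |⟨u|v⟩|)²`. -/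
theorem norm_inner_sq_add_le (u v x : E) (hu : ‖u‖ = 1) (hv : ‖v‖ = 1) :
    ‖inner ℂ x v‖ ^ 2 + ‖inner ℂ x u‖ ^ 2
        + 2 * (inner ℂ u x * inner ℂ x v * inner ℂ v u).re
      ≤ (1 + ‖inner ℂ u v‖) ^ 2 * ‖x‖ ^ 2 := by
  set s := ‖inner ℂ u v‖ with hs
  set p := ‖inner ℂ x u‖ with hp
  set q := ‖inner ℂ x v‖ with hq
  have hs0 : 0 ≤ s := norm_nonneg _
  have hre : (inner ℂ u x * inner ℂ x v * inner ℂ v u).re ≤ p * q * s := by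
    refine (Complex.re_le_norm _).trans_eq ?_
    rw [norm_mul, norm_mul, norm_inner_symm u x, norm_inner_symm v u]
  -- `y = T x` for `T = |u⟩⟨u| + |v⟩⟨v|`, and `p² + q² = ⟨x, T x⟩`. Cauchy–Schwarz together with
  -- `2pqs ≤ s(p² + q²)` gives `T ≤ 1 + s`; the same inequality supplies the second factor `1 + s`
  -- at the end.
  set y := inner ℂ u x • u + inner ℂ v x • v with hy
  have hpq : p ^ 2 + q ^ 2 ≤ ‖x‖ * ‖y‖ := by
    have h1 : inner ℂ x y = ((p ^ 2 + q ^ 2 : ℝ) : ℂ) := by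
      rw [hy, inner_add_right, inner_smul_right, inner_smul_right, ← inner_conj_symm u x,
        ← inner_conj_symm v x, ← Complex.normSq_eq_conj_mul_self,
        ← Complex.normSq_eq_conj_mul_self, Complex.normSq_eq_norm_sq, Complex.normSq_eq_norm_sq,
        ← Complex.ofReal_add]
    have h2 := norm_inner_le_norm (𝕜 := ℂ) x y
    rwa [h1, Complex.norm_real, Real.norm_of_nonneg (by positivity)] at h2
  have hyn : ‖y‖ ^ 2 ≤ (1 + s) * (p ^ 2 + q ^ 2) := by
    have h1 : ‖y‖ ^ 2 ≤ p ^ 2 + q ^ 2 + 2 * (p * q * s) := by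
      rw [hy, norm_add_sq (𝕜 := ℂ), norm_smul, norm_smul, hu, hv, norm_inner_symm u x,
        norm_inner_symm v x, mul_one, mul_one]
      have : RCLike.re (inner ℂ (inner ℂ u x • u) (inner ℂ v x • v)) ≤ p * q * s := by
        refine (RCLike.re_le_norm _).trans_eq ?_
        rw [inner_smul_left, inner_smul_right, norm_mul, norm_mul, RCLike.norm_conj,
          norm_inner_symm u x, norm_inner_symm v x, mul_assoc]
      linarith
    nlinarith [mul_nonneg hs0 (sq_nonneg (p - q))]
  have hle : p ^ 2 + q ^ 2 ≤ (1 + s) * ‖x‖ ^ 2 := by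
    have h1 : (p ^ 2 + q ^ 2) * (p ^ 2 + q ^ 2) ≤ (1 + s) * ‖x‖ ^ 2 * (p ^ 2 + q ^ 2) := by
      calc (p ^ 2 + q ^ 2) * (p ^ 2 + q ^ 2) ≤ (‖x‖ * ‖y‖) * (‖x‖ * ‖y‖) := by gcongr
        _ = ‖x‖ ^ 2 * ‖y‖ ^ 2 := by ring
        _ ≤ ‖x‖ ^ 2 * ((1 + s) * (p ^ 2 + q ^ 2)) := by gcongr
        _ = _ := by ring
    rcases (by positivity : 0 ≤ p ^ 2 + q ^ 2).eq_or_lt with h0 | h0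
    · rw [← h0]; positivity
    · exact le_of_mul_le_mul_right h1 h0
  nlinarith [mul_nonneg hs0 (sq_nonneg (p - q)),
    mul_le_mul_of_nonneg_left hle (by positivity : 0 ≤ 1 + s)]

/-- The bound `norm_inner_sq_add_le` is attained. -/
theorem exists_norm_inner_sq_add_eq (u v : E) (hu : ‖u‖ = 1) (hv : ‖v‖ = 1) :
    ∃ x : E, ‖x‖ = 1 ∧ ‖inner ℂ x v‖ ^ 2 + ‖inner ℂ x u‖ ^ 2
        + 2 * (inner ℂ u x * inner ℂ x v * inner ℂ v u).re = (1 + ‖inner ℂ u v‖) ^ 2 := by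
  -- Once the phase `ω` makes the inner product of `u` and `ω v` nonnegative, their sum is an
  -- eigenvector of `T` for the eigenvalue `1 + s`.
  obtain ⟨ω, hω, hs⟩ : ∃ ω : ℂ, ‖ω‖ = 1 ∧ inner ℂ u v * ω = ‖inner ℂ u v‖ := by
    obtain ⟨c, hc, h⟩ := RCLike.exists_norm_eq_mul_self (inner ℂ u v)
    exact ⟨c, hc, by rw [mul_comm]; exact h.symm⟩
  set s := ‖inner ℂ u v‖ with hsd
  have hs0 : 0 ≤ s := norm_nonneg _
  have hωω : (starRingEnd ℂ) ω * ω = 1 := by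
    rw [← Complex.normSq_eq_conj_mul_self, Complex.normSq_eq_norm_sq, hω]; simp
  have hvu : inner ℂ v u = s * ω := by
    have : (starRingEnd ℂ) (inner ℂ u v * ω) = s := by rw [hs, Complex.conj_ofReal]
    rw [map_mul, inner_conj_symm] at this
    linear_combination ω * this - inner ℂ v u * hωω
  set y := u + ω • v with hy
  have huu : inner ℂ u u = (1 : ℂ) := by rw [inner_self_eq_norm_sq_to_K, hu]; simp
  have hvv : inner ℂ v v = (1 : ℂ) := by rw [inner_self_eq_norm_sq_to_K, hv]; simp
  have huy : inner ℂ u y = ((1 + s : ℝ) : ℂ) := by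
    rw [hy, inner_add_right, inner_smul_right, huu, mul_comm, hs]; push_cast; ring
  have hvy : inner ℂ v y = ((1 + s : ℝ) : ℂ) * ω := by
    rw [hy, inner_add_right, inner_smul_right, hvv, hvu]; push_cast; ring
  have hyu : inner ℂ y u = ((1 + s : ℝ) : ℂ) := by
    rw [← inner_conj_symm, huy, Complex.conj_ofReal]
  have hyv : inner ℂ y v = ((1 + s : ℝ) : ℂ) * (starRingEnd ℂ) ω := by
    rw [← inner_conj_symm, hvy, map_mul, Complex.conj_ofReal]
  have hyy : ‖y‖ ^ 2 = 2 * (1 + s) := by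
    have h1 : inner ℂ y y = ((2 * (1 + s) : ℝ) : ℂ) := by
      conv_lhs => rw [hy]
      rw [inner_add_left, inner_smul_left, huy, hvy]
      push_cast
      linear_combination (1 + s : ℂ) * hωω
    rw [inner_self_eq_norm_sq_to_K] at h1
    refine Complex.ofReal_injective (Eq.trans ?_ h1)
    push_cast
    rfl
  have hy0 : 0 < ‖y‖ := by
    by_contra h
    have : ‖y‖ = 0 := le_antisymm (not_lt.mp h) (norm_nonneg _)
    rw [this] at hyy; linarith
  have hT : inner ℂ u y * inner ℂ y v * inner ℂ v u = (((1 + s) ^ 2 * s : ℝ) : ℂ) := by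
    rw [huy, hyv, hvu]; push_cast
    linear_combination ((1 + s) ^ 2 * s : ℂ) * hωω
  refine ⟨((‖y‖⁻¹ : ℝ) : ℂ) • y, ?_, ?_⟩
  · rw [norm_smul, Complex.norm_real, norm_inv, norm_norm, inv_mul_cancel₀ hy0.ne']
  · have h3 : inner ℂ u (((‖y‖⁻¹ : ℝ) : ℂ) • y) * inner ℂ (((‖y‖⁻¹ : ℝ) : ℂ) • y) v * inner ℂ v u
        = (((‖y‖⁻¹) ^ 2 * ((1 + s) ^ 2 * s) : ℝ) : ℂ) := by
      rw [inner_smul_left, inner_smul_right, Complex.conj_ofReal]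
      push_cast at hT ⊢
      linear_combination (‖y‖⁻¹ : ℂ) ^ 2 * hT
    rw [h3, Complex.ofReal_re, inner_smul_left, inner_smul_left, hyu, hyv, norm_mul, norm_mul,
      norm_mul, RCLike.norm_conj, RCLike.norm_conj, hω, Complex.norm_real, Complex.norm_real,
      norm_inv, norm_norm, Real.norm_of_nonneg (by positivity)]
    have h4 : (‖y‖⁻¹) ^ 2 * (2 * (1 + s)) = 1 := by
      rw [← hyy, ← mul_pow, inv_mul_cancel₀ hy0.ne', one_pow]
    linear_combination (1 + s) ^ 2 * h4

end PairBound

/-! ### Traces of tensor products and rank-one operators. -/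

section Traces

theorem trace_tensorOp {d N : ℕ} (M : Fin N → Matrix (Fin d) (Fin d) ℂ) :
    (tensorOp M).trace = ∏ i, (M i).trace := by
  simp only [Matrix.trace, tensorOp, Matrix.diag_apply, Matrix.of_apply]
  rw [Finset.prod_univ_sum, Fintype.piFinset_univ]

theorem tensorOp_mul {d N : ℕ} (M L : Fin N → Matrix (Fin d) (Fin d) ℂ) :
    tensorOp M * tensorOp L = tensorOp fun i => M i * L i := by
  ext a b
  simp only [tensorOp, Matrix.mul_apply, Matrix.of_apply, ← Finset.prod_mul_distrib]
  rw [Finset.prod_univ_sum, Fintype.piFinset_univ]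

theorem PosSemidef.eq_smul_vecMulVec_of_rank_eq_one {d : ℕ} {A : Matrix (Fin d) (Fin d) ℂ}
    (hA : A.PosSemidef) (hr : A.rank = 1) :
    ∃ a : ℝ, 0 < a ∧ ∃ v : EuclideanSpace ℂ (Fin d), ‖v‖ = 1 ∧
      A = (a : ℂ) • vecMulVec v.ofLp (star v.ofLp) := by
  have hH := hA.isHermitian
  rw [hH.rank_eq_card_non_zero_eigs, Fintype.card_eq_one_iff] at hr
  obtain ⟨⟨i, hi⟩, huniq⟩ := hr
  refine ⟨hH.eigenvalues i, lt_of_le_of_ne (hA.eigenvalues_nonneg i) (Ne.symm hi),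
    hH.eigenvectorBasis i, hH.eigenvectorBasis.norm_eq_one i, ?_⟩
  ext p q
  conv_lhs => rw [hH.spectral_theorem]
  rw [Unitary.conjStarAlgAut_apply, Matrix.mul_apply]
  rw [Finset.sum_eq_single i]
  · simp [Matrix.mul_diagonal, vecMulVec_apply, Matrix.star_apply,
      Matrix.IsHermitian.eigenvectorUnitary_apply]
    ring
  · intro j _ hj
    have : hH.eigenvalues j = 0 := by
      by_contra h
      exact hj (congrArg Subtype.val (huniq ⟨j, h⟩))
    simp [Matrix.mul_diagonal, this]
  · simp

theorem trace_vecMulVec_star {d : ℕ} (x : EuclideanSpace ℂ (Fin d)) :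
    (vecMulVec x.ofLp (star x.ofLp)).trace = ((‖x‖ ^ 2 : ℝ) : ℂ) := by
  rw [trace_vecMulVec, ← EuclideanSpace.inner_eq_star_dotProduct, inner_self_eq_norm_sq_to_K]
  push_cast
  rfl

theorem vecMulVec_star_mul {d : ℕ} (x y : EuclideanSpace ℂ (Fin d)) :
    vecMulVec x.ofLp (star x.ofLp) * vecMulVec y.ofLp (star y.ofLp)
      = inner ℂ x y • vecMulVec x.ofLp (star y.ofLp) := by
  rw [vecMulVec_mul_vecMulVec, EuclideanSpace.inner_eq_star_dotProduct, dotProduct_comm]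
  ext a b
  simp [vecMulVec_apply]
  ring

theorem trace_vecMulVec_star_mul {d : ℕ} (x y : EuclideanSpace ℂ (Fin d)) :
    (vecMulVec x.ofLp (star x.ofLp) * vecMulVec y.ofLp (star y.ofLp)).trace
      = ((‖inner ℂ x y‖ ^ 2 : ℝ) : ℂ) := by
  rw [vecMulVec_star_mul, trace_smul, trace_vecMulVec, ← EuclideanSpace.inner_eq_star_dotProduct,
    smul_eq_mul, ← inner_conj_symm y x, Complex.mul_conj, Complex.normSq_eq_norm_sq]

end Traces

/-! ### Two-copy fidelity as a sum over pairs of outcomes. -/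

section Fidelity

variable {d : ℕ} [NeZero d]

/-- The estimator is a sum of unnormalized rank-one terms, so that one formula serves both the
optimal pure estimator (`m = 1`) and an arbitrary density operator. -/
theorem integral_fidelity_eq {κ : Type*} (u v : EuclideanSpace ℂ (Fin d)) (a b : ℝ)
    {A : κ → Matrix (Fin d) (Fin d) ℂ} {j k : κ}
    (hj : A j = (a : ℂ) • vecMulVec u.ofLp (star u.ofLp))
    (hk : A k = (b : ℂ) • vecMulVec v.ofLp (star v.ofLp))
    {m : ℕ} (x : Fin m → EuclideanSpace ℂ (Fin d)) :
    ∫ U, (tensorOp (fun _ : Fin 2 => pureState U) * twoCopy A (j, k)).trace.re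
        * (pureState U * ∑ i, vecMulVec (x i).ofLp (star (x i).ofLp)).trace.re ∂(haarUnitary d)
      = a * b * ∑ i, haarMean d (overlap u * overlap v * overlap (x i)) := by
  rw [← map_sum, ← smul_eq_mul, ← map_smul, haarMean_apply]
  congr 1
  ext U
  rw [twoCopy, tensorOp_mul, trace_tensorOp, Fin.prod_univ_two, Finset.mul_sum, trace_sum]
  simp only [trace_pureState_mul_vecMulVec, Matrix.cons_val_zero, Matrix.cons_val_one, hj, hk,
    Matrix.mul_smul, trace_smul, smul_eq_mul, ContinuousMap.smul_apply, ContinuousMap.coe_sum,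
    Finset.sum_apply, ContinuousMap.mul_apply, overlap_apply, ← Finset.mul_sum]
  rw [← Complex.ofReal_sum, Complex.ofReal_re, ← Complex.ofReal_mul, ← Complex.ofReal_mul,
    ← Complex.ofReal_mul, Complex.ofReal_re]
  ring

/-- The optimal contribution of a pair of outcomes to the two-copy fidelity, for unit vectors with
overlap `s`. -/
noncomputable def pairFidelity (d : ℕ) (s : ℝ) : ℝ :=
  2 / (d * (d + 1) * (d + 2)) * (1 + s ^ 2 + s)

/-- For unit `u, v` the permanent splits into `(1 + s²)‖x‖²` and the quadratic form bounded by `(1 +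
s)²‖x‖²`; together `2(1 + s + s²)‖x‖²`. -/
theorem haarMean_overlap_mul_le (u v x : EuclideanSpace ℂ (Fin d)) (hu : ‖u‖ = 1) (hv : ‖v‖ = 1) :
    haarMean d (overlap u * overlap v * overlap x)
      ≤ pairFidelity d ‖inner ℂ u v‖ * ‖x‖ ^ 2 := by
  rw [haarMean_overlap_mul, pairFidelity, hu, hv]
  have h := norm_inner_sq_add_le u v x hu hv
  have h0 : (0 : ℝ) ≤ 1 / (d * (d + 1) * (d + 2)) := by positivity
  refine (mul_le_mul_of_nonneg_left (b := _)
    (c := (2 * (1 + ‖inner ℂ u v‖ ^ 2 + ‖inner ℂ u v‖)) * ‖x‖ ^ 2) ?_ h0).trans_eq (by ring)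
  nlinarith

theorem exists_haarMean_overlap_mul_eq (u v : EuclideanSpace ℂ (Fin d)) (hu : ‖u‖ = 1)
    (hv : ‖v‖ = 1) :
    ∃ x : EuclideanSpace ℂ (Fin d), ‖x‖ = 1 ∧
      haarMean d (overlap u * overlap v * overlap x) = pairFidelity d ‖inner ℂ u v‖ := by
  obtain ⟨x, hx, h⟩ := exists_norm_inner_sq_add_eq u v hu hv
  refine ⟨x, hx, ?_⟩
  rw [haarMean_overlap_mul, pairFidelity, hu, hv, hx]
  linear_combination 1 / (d * (d + 1) * (d + 2) : ℝ) * h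

theorem estimationFidelity_twoCopy {κ : Type*} [Fintype κ] {A : κ → Matrix (Fin d) (Fin d) ℂ}
    {a : κ → ℝ} {v : κ → EuclideanSpace ℂ (Fin d)} (ha : ∀ j, 0 < a j) (hv : ∀ j, ‖v j‖ = 1)
    (hA : ∀ j, A j = (a j : ℂ) • vecMulVec (v j).ofLp (star (v j).ofLp)) :
    estimationFidelity (twoCopy A)
      = ∑ jk : κ × κ, a jk.1 * a jk.2 * pairFidelity d ‖inner ℂ (v jk.1) (v jk.2)‖ := by
  refine IsGreatest.csSup_eq ⟨?_, ?_⟩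
  · choose x hx hxe using fun jk : κ × κ =>
      exists_haarMean_overlap_mul_eq (v jk.1) (v jk.2) (hv jk.1) (hv jk.2)
    refine ⟨fun jk => vecMulVec (x jk).ofLp (star (x jk).ofLp),
      fun jk => ⟨posSemidef_vecMulVec_self_star _, ?_⟩, ?_⟩
    · rw [trace_vecMulVec_star, hx]; simp
    · refine Finset.sum_congr rfl fun jk _ => ?_
      have h := integral_fidelity_eq _ _ _ _ (hA jk.1) (hA jk.2) (fun _ : Fin 1 => x jk)
      simp only [Fin.sum_univ_one, hxe] at h
      exact h.symm
  · rintro _ ⟨σ, hσ, rfl⟩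
    refine Finset.sum_le_sum fun jk _ => ?_
    -- The average fidelity is linear in the estimator and trace one means `∑ ‖x i‖² = 1`, so mixed
    -- estimators cannot beat pure ones.
    obtain ⟨m, x, hx⟩ := Matrix.posSemidef_iff_eq_sum_vecMulVec.mp (hσ jk).1
    have hx' : σ jk = ∑ i, vecMulVec (WithLp.toLp 2 (x i) : EuclideanSpace ℂ (Fin d)).ofLp
        (star (WithLp.toLp 2 (x i) : EuclideanSpace ℂ (Fin d)).ofLp) := hx
    have ht : ∑ i, ‖(WithLp.toLp 2 (x i) : EuclideanSpace ℂ (Fin d))‖ ^ 2 = 1 := by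
      refine Complex.ofReal_injective ?_
      rw [Complex.ofReal_one, ← (hσ jk).2, hx', trace_sum, Complex.ofReal_sum]
      exact Finset.sum_congr rfl fun i _ => (trace_vecMulVec_star (WithLp.toLp 2 (x i))).symm
    rw [hx', integral_fidelity_eq _ _ _ _ (hA jk.1) (hA jk.2)]
    have h0 := mul_nonneg (ha jk.1).le (ha jk.2).le
    refine mul_le_mul_of_nonneg_left ?_ h0
    calc _ ≤ ∑ i, pairFidelity d ‖inner ℂ (v jk.1) (v jk.2)‖
          * ‖(WithLp.toLp 2 (x i) : EuclideanSpace ℂ (Fin d))‖ ^ 2 :=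
          Finset.sum_le_sum fun i _ => haarMean_overlap_mul_le _ _ _ (hv _) (hv _)
      _ = _ := by rw [← Finset.mul_sum, ht, mul_one]

end Fidelity

/-! ### Tensors behind the frame potential bound. -/

section FramePotential

variable {d : ℕ}

/-- The tensor `v ⊗ v ⊗ v̄ ⊗ v̄`. -/
noncomputable def fourTensor (v : EuclideanSpace ℂ (Fin d)) :
    EuclideanSpace ℂ (Fin d × Fin d × Fin d × Fin d) :=
  WithLp.toLp 2 fun p => v p.1 * (v p.2.1 * (star (v p.2.2.1) * star (v p.2.2.2)))

/-- Twice the projector onto the symmetric subspace, as a tensor. -/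
noncomputable def symTensor (d : ℕ) : EuclideanSpace ℂ (Fin d × Fin d × Fin d × Fin d) :=
  WithLp.toLp 2 fun p => (if p.1 = p.2.2.1 then if p.2.1 = p.2.2.2 then 1 else 0 else 0)
    + (if p.1 = p.2.2.2 then if p.2.1 = p.2.2.1 then 1 else 0 else 0)

theorem inner_fourTensor (u v : EuclideanSpace ℂ (Fin d)) :
    inner ℂ (fourTensor u) (fourTensor v) = ((‖inner ℂ u v‖ ^ 4 : ℝ) : ℂ) := by
  have h1 : inner ℂ u v = ∑ i, star (u i) * v i := by
    simp [PiLp.inner_apply, mul_comm]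
  have h2 : inner ℂ v u = ∑ i, u i * star (v i) := by
    simp [PiLp.inner_apply]
  have h3 : ((‖inner ℂ u v‖ ^ 4 : ℝ) : ℂ)
      = inner ℂ u v * (inner ℂ u v * (inner ℂ v u * inner ℂ v u)) := by
    rw [← inner_conj_symm v u]
    have := Complex.mul_conj (inner ℂ u v)
    rw [Complex.normSq_eq_norm_sq] at this
    push_cast at this ⊢
    linear_combination (-(‖inner ℂ u v‖ : ℂ) ^ 2
      - inner ℂ u v * (starRingEnd ℂ) (inner ℂ u v)) * this
  rw [h3, h1, h2]
  have h4 : inner ℂ (fourTensor u) (fourTensor v) = ∑ i, ∑ j, ∑ k, ∑ l,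
      (star (u i) * v i) * ((star (u j) * v j) * ((u k * star (v k)) * (u l * star (v l)))) := by
    simp only [PiLp.inner_apply, Fintype.sum_prod_type, fourTensor]
    refine Finset.sum_congr rfl fun i _ => Finset.sum_congr rfl fun j _ =>
      Finset.sum_congr rfl fun k _ => Finset.sum_congr rfl fun l _ => ?_
    simp
    ring
  rw [h4]
  simp only [← Finset.mul_sum, ← Finset.sum_mul]

theorem inner_symTensor_fourTensor (v : EuclideanSpace ℂ (Fin d)) (hv : ‖v‖ = 1) :
    inner ℂ (symTensor d) (fourTensor v) = 2 := by
  have h1 : ∑ i, v i * star (v i) = 1 := by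
    have : inner ℂ v v = (1 : ℂ) := by rw [inner_self_eq_norm_sq_to_K, hv]; simp
    rw [← this, PiLp.inner_apply]
    exact Finset.sum_congr rfl fun i _ => (RCLike.inner_apply _ _).symm
  have h4 : inner ℂ (symTensor d) (fourTensor v) = ∑ i, ∑ j,
      2 * ((v i * star (v i)) * (v j * star (v j))) := by
    simp only [PiLp.inner_apply, Fintype.sum_prod_type, fourTensor, symTensor]
    refine Finset.sum_congr rfl fun i _ => Finset.sum_congr rfl fun j _ => ?_
    simp [mul_add, Finset.sum_add_distrib, apply_ite (starRingEnd ℂ), Finset.sum_ite_eq]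
    ring
  rw [h4]
  simp only [← Finset.mul_sum, ← Finset.sum_mul, h1]
  norm_num

theorem norm_symTensor_sq : ‖symTensor d‖ ^ 2 = 2 * d ^ 2 + 2 * d := by
  rw [EuclideanSpace.norm_sq_eq]
  -- The cross term survives only where identity and swap entries are both 1, that is, when all four
  -- indices agree.
  have h : ∀ i j k l : Fin d, ‖symTensor d (i, j, k, l)‖ ^ 2
      = (if i = k then if j = l then 1 else 0 else 0)
        + (if i = l then if j = k then 1 else 0 else 0)
        + 2 * (if i = l then if j = k then if i = j then 1 else 0 else 0 else (0 : ℝ)) := by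
    intro i j k l
    simp only [symTensor]
    split_ifs <;> first | (exfalso; omega) | norm_num
  simp only [Fintype.sum_prod_type, h]
  simp [Finset.sum_add_distrib]
  ring

end FramePotential

/-! ### Bounds on the sum of overlaps, and their equality cases. -/

section Frame

variable {d : ℕ} {κ : Type*} [Fintype κ] {a : κ → ℝ} {v : κ → EuclideanSpace ℂ (Fin d)}

/-- The lower bound on the frame potential of a weighted family of unit vectors. -/
theorem two_mul_le_framePotential (hv : ∀ j, ‖v j‖ = 1) (hsum : ∑ j, a j = d) :
    2 * (d : ℝ) / (d + 1) ≤ ∑ j, ∑ k, a j * a k * ‖inner ℂ (v j) (v k)‖ ^ 4 := by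
  set T := ∑ j, (a j : ℂ) • fourTensor (v j) with hT
  have hTT : ‖T‖ ^ 2 = ∑ j, ∑ k, a j * a k * ‖inner ℂ (v j) (v k)‖ ^ 4 := by
    refine Complex.ofReal_injective ?_
    have h1 : ((‖T‖ ^ 2 : ℝ) : ℂ) = inner ℂ T T := by
      rw [inner_self_eq_norm_sq_to_K]; push_cast; rfl
    rw [h1, hT, sum_inner]
    simp only [inner_sum, inner_smul_left, inner_smul_right, inner_fourTensor,
      Complex.conj_ofReal]
    push_cast
    exact Finset.sum_congr rfl fun j _ => Finset.sum_congr rfl fun k _ => by ring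
  have hG : inner ℂ (symTensor d) T = ((2 * d : ℝ) : ℂ) := by
    rw [hT, inner_sum]
    simp only [inner_smul_right, inner_symTensor_fourTensor _ (hv _)]
    rw [← Finset.sum_mul, ← Complex.ofReal_sum, hsum]
    push_cast
    ring
  have hCS := norm_inner_le_norm (𝕜 := ℂ) (symTensor d) T
  rw [hG, Complex.norm_real, Real.norm_of_nonneg (by positivity)] at hCS
  -- Cauchy–Schwarz against `symTensor`: each `fourTensor (v j)` pairs to 2 with it and the weights
  -- sum to `d`.
  have h2 : (2 * d : ℝ) ^ 2 ≤ (2 * d ^ 2 + 2 * d) * ‖T‖ ^ 2 := by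
    rw [← norm_symTensor_sq, ← mul_pow]
    gcongr
  rw [← hTT, div_le_iff₀ (by positivity)]
  rcases Nat.eq_zero_or_pos d with h0 | h0
  · subst h0; simp
  · have : (0 : ℝ) < 2 * d := by positivity
    refine le_of_mul_le_mul_left ?_ this
    linarith

variable {A : κ → Matrix (Fin d) (Fin d) ℂ}

theorem sum_mul_norm_inner_sq (hA : ∀ j, A j = (a j : ℂ) • vecMulVec (v j).ofLp (star (v j).ofLp))
    (hsum : ∑ j, A j = 1) (x : EuclideanSpace ℂ (Fin d)) :
    ∑ k, a k * ‖inner ℂ x (v k)‖ ^ 2 = ‖x‖ ^ 2 := by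
  have h : (vecMulVec x.ofLp (star x.ofLp) * ∑ j, A j).trace = ((‖x‖ ^ 2 : ℝ) : ℂ) := by
    rw [hsum, mul_one, trace_vecMulVec_star]
  rw [Finset.mul_sum, trace_sum] at h
  simp only [hA, Matrix.mul_smul, trace_smul, trace_vecMulVec_star_mul, smul_eq_mul] at h
  exact_mod_cast h

theorem sum_weights (hv : ∀ j, ‖v j‖ = 1)
    (hA : ∀ j, A j = (a j : ℂ) • vecMulVec (v j).ofLp (star (v j).ofLp))
    (hsum : ∑ j, A j = 1) : ∑ j, a j = d := by
  have h : (∑ j, A j).trace = d := by rw [hsum, trace_one, Fintype.card_fin]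
  rw [trace_sum] at h
  simp only [hA, trace_smul, trace_vecMulVec_star, hv, smul_eq_mul] at h
  simp only [one_pow, Complex.ofReal_one, mul_one] at h
  exact_mod_cast h

theorem sum_sum_mul_norm_inner_sq (hv : ∀ j, ‖v j‖ = 1)
    (hA : ∀ j, A j = (a j : ℂ) • vecMulVec (v j).ofLp (star (v j).ofLp))
    (hsum : ∑ j, A j = 1) :
    ∑ j, ∑ k, a j * a k * ‖inner ℂ (v j) (v k)‖ ^ 2 = d := by
  simp only [mul_assoc, ← Finset.mul_sum, sum_mul_norm_inner_sq hA hsum, hv, one_pow, mul_one]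
  exact sum_weights hv hA hsum

theorem sum_sum_weights (hsum : ∑ j, a j = d) : ∑ j, ∑ k, a j * a k = (d : ℝ) ^ 2 := by
  rw [← Finset.sum_mul_sum, hsum, sq]

/-- The two-copy estimation fidelity in terms of the overlaps. -/
theorem estimationFidelity_eq [NeZero d] (ha : ∀ j, 0 < a j) (hv : ∀ j, ‖v j‖ = 1)
    (hA : ∀ j, A j = (a j : ℂ) • vecMulVec (v j).ofLp (star (v j).ofLp))
    (hsum : ∑ j, A j = 1) :
    estimationFidelity (twoCopy A) = 2 / (d * (d + 1) * (d + 2))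
      * (d ^ 2 + d + ∑ j, ∑ k, a j * a k * ‖inner ℂ (v j) (v k)‖) := by
  rw [estimationFidelity_twoCopy ha hv hA, Fintype.sum_prod_type,
    ← sum_sum_weights (sum_weights hv hA hsum)]
  -- This also replaces the `d` in the prefactor; the closing rewrite restores it term by term.
  conv_rhs => rw [← sum_sum_mul_norm_inner_sq hv hA hsum]
  simp only [← Finset.sum_add_distrib, Finset.mul_sum, pairFidelity]
  exact Finset.sum_congr rfl fun j _ => Finset.sum_congr rfl fun k _ => by
    rw [sum_sum_mul_norm_inner_sq hv hA hsum]; ring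

/-- The factor `s + 1 + 2t` is the one that cancels the cubic term, since no third moment of the
overlaps is known. Both summands on the left are nonnegative, so the identity gives the upper bound
on the overlap sum and its equality case at once. -/
theorem sum_quartic_eq (hv : ∀ j, ‖v j‖ = 1)
    (hA : ∀ j, A j = (a j : ℂ) • vecMulVec (v j).ofLp (star (v j).ofLp))
    (hsum : ∑ j, A j = 1) {t : ℝ} (ht : (d + 1) * t ^ 2 = 1) (ht0 : 0 < t) :
    ∑ j, ∑ k, a j * a k * ((‖inner ℂ (v j) (v k)‖ - t) ^ 2
        * ((1 - ‖inner ℂ (v j) (v k)‖) * (‖inner ℂ (v j) (v k)‖ + 1 + 2 * t)))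
      + (∑ j, ∑ k, a j * a k * ‖inner ℂ (v j) (v k)‖ ^ 4 - 2 * d / (d + 1))
      = 2 * t * (1 + t) ^ 2
        * (1 + (d - 1) * t⁻¹ - ∑ j, ∑ k, a j * a k * ‖inner ℂ (v j) (v k)‖) := by
  have h0 := sum_sum_weights (sum_weights hv hA hsum)
  have h2 := sum_sum_mul_norm_inner_sq hv hA hsum
  have hexp : ∑ j, ∑ k, a j * a k * ((‖inner ℂ (v j) (v k)‖ - t) ^ 2
        * ((1 - ‖inner ℂ (v j) (v k)‖) * (‖inner ℂ (v j) (v k)‖ + 1 + 2 * t)))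
      = -∑ j, ∑ k, a j * a k * ‖inner ℂ (v j) (v k)‖ ^ 4
        + (1 + 2 * t + 3 * t ^ 2) * ∑ j, ∑ k, a j * a k * ‖inner ℂ (v j) (v k)‖ ^ 2
        - 2 * t * (1 + t) ^ 2 * ∑ j, ∑ k, a j * a k * ‖inner ℂ (v j) (v k)‖
        + t ^ 2 * (1 + 2 * t) * ∑ j, ∑ k, a j * a k := by
    simp only [Finset.mul_sum, ← Finset.sum_add_distrib, ← Finset.sum_sub_distrib,
      ← Finset.sum_neg_distrib]
    exact Finset.sum_congr rfl fun j _ => Finset.sum_congr rfl fun k _ => by ring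
  rw [hexp, h0, h2]
  have hd : (d : ℝ) = (t ^ 2)⁻¹ - 1 := by
    field_simp
    linear_combination ht
  have hd1 : 2 * (d : ℝ) / (d + 1) = 2 * d * t ^ 2 := by
    rw [div_eq_iff (by positivity)]
    linear_combination -2 * (d : ℝ) * ht
  rw [hd1, hd]
  field_simp
  ring

omit [Fintype κ] in
theorem norm_inner_le_one (hv : ∀ j, ‖v j‖ = 1) (j k : κ) : ‖inner ℂ (v j) (v k)‖ ≤ 1 := by
  simpa [hv] using norm_inner_le_norm (𝕜 := ℂ) (v j) (v k)

omit [Fintype κ] in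
-- Equality in Cauchy–Schwarz makes the two vectors differ by a phase, so they define the same
-- projector and `a k • A j = a j • A k`.
theorem norm_inner_ne_one_of_isSimple (ha : ∀ j, 0 < a j) (hv : ∀ j, ‖v j‖ = 1)
    (hA : ∀ j, A j = (a j : ℂ) • vecMulVec (v j).ofLp (star (v j).ofLp))
    (hS : IsSimple A) {j k : κ} (hjk : j ≠ k) : ‖inner ℂ (v j) (v k)‖ ≠ 1 := by
  intro h
  have hne : ∀ i, v i ≠ 0 := fun i h0 => by simpa [h0] using hv i
  obtain ⟨r, -, hr⟩ := (norm_inner_eq_norm_iff (𝕜 := ℂ) (hne j) (hne k)).mp (by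
    rw [h, hv, hv, one_mul])
  have hr1 : r * star r = 1 := by
    have h1 : ‖r‖ = 1 := by
      have := hv k
      rwa [hr, norm_smul, hv, mul_one] at this
    have := Complex.mul_conj r
    rw [Complex.normSq_eq_norm_sq, h1] at this
    simpa using this
  have hP : vecMulVec (v k).ofLp (star (v k).ofLp) = vecMulVec (v j).ofLp (star (v j).ofLp) := by
    ext p q
    rw [hr]
    simp only [vecMulVec_apply, WithLp.ofLp_smul, Pi.smul_apply, Pi.star_apply,
      smul_eq_mul, star_mul]
    linear_combination (v j) p * star ((v j) q) * hr1
  have := (LinearIndependent.pair_iff.mp (hS j k hjk) (a k) (-(a j))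
    (by rw [hA j, hA k, hP, smul_smul, smul_smul, ← add_smul]; ring_nf; simp)).1
  exact (ha k).ne' (by exact_mod_cast this)

omit [Fintype κ] in
theorem norm_inner_self_eq_one (hv : ∀ j, ‖v j‖ = 1) (j : κ) : ‖inner ℂ (v j) (v j)‖ = 1 := by
  rw [inner_self_eq_norm_sq_to_K, hv]; simp

theorem le_sum_overlaps (ha : ∀ j, 0 < a j) (hv : ∀ j, ‖v j‖ = 1)
    (hA : ∀ j, A j = (a j : ℂ) • vecMulVec (v j).ofLp (star (v j).ofLp))
    (hsum : ∑ j, A j = 1) : (d : ℝ) ≤ ∑ j, ∑ k, a j * a k * ‖inner ℂ (v j) (v k)‖ := by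
  rw [← sum_sum_mul_norm_inner_sq hv hA hsum]
  refine Finset.sum_le_sum fun j _ => Finset.sum_le_sum fun k _ => ?_
  have := norm_inner_le_one hv j k
  have := norm_nonneg (inner ℂ (v j) (v k))
  exact mul_le_mul_of_nonneg_left (by nlinarith) (mul_pos (ha j) (ha k)).le

theorem sum_overlaps_eq_iff_isRankOneProjective (ha : ∀ j, 0 < a j) (hv : ∀ j, ‖v j‖ = 1)
    (hA : ∀ j, A j = (a j : ℂ) • vecMulVec (v j).ofLp (star (v j).ofLp))
    (hsum : ∑ j, A j = 1) (hpos : ∀ j, (A j).PosSemidef) (hrank : IsRankOne A)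
    (hS : IsSimple A) :
    ∑ j, ∑ k, a j * a k * ‖inner ℂ (v j) (v k)‖ = d ↔ IsRankOneProjective A := by
  constructor
  · intro h
    have h0 : ∑ j, ∑ k, a j * a k * (‖inner ℂ (v j) (v k)‖ - ‖inner ℂ (v j) (v k)‖ ^ 2) = 0 := by
      simp only [mul_sub, Finset.sum_sub_distrib]
      rw [h, sum_sum_mul_norm_inner_sq hv hA hsum, sub_self]
    have hnn : ∀ j k, 0 ≤ a j * a k * (‖inner ℂ (v j) (v k)‖ - ‖inner ℂ (v j) (v k)‖ ^ 2) := by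
      intro j k
      have := norm_inner_le_one hv j k
      have := norm_nonneg (inner ℂ (v j) (v k))
      exact mul_nonneg (mul_pos (ha j) (ha k)).le (by nlinarith)
    have horth : ∀ j k, j ≠ k → A j * A k = 0 := by
      intro j k hjk
      have h1 := (Finset.sum_eq_zero_iff_of_nonneg fun j _ =>
        Finset.sum_nonneg fun k _ => hnn j k).mp h0 j (Finset.mem_univ _)
      have h2 := (Finset.sum_eq_zero_iff_of_nonneg fun k _ => hnn j k).mp h1 k (Finset.mem_univ _)
      have h3 := (mul_eq_zero.mp h2).resolve_left (mul_pos (ha j) (ha k)).ne'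
      have h4 : ‖inner ℂ (v j) (v k)‖ * (1 - ‖inner ℂ (v j) (v k)‖) = 0 := by
        linear_combination h3
      have h5 : inner ℂ (v j) (v k) = (0 : ℂ) := by
        rcases mul_eq_zero.mp h4 with h5 | h5
        · exact norm_eq_zero.mp h5
        · exact absurd (sub_eq_zero.mp h5).symm (norm_inner_ne_one_of_isSimple ha hv hA hS hjk)
      rw [hA j, hA k, Matrix.smul_mul, Matrix.mul_smul, vecMulVec_star_mul, h5]
      simp
    refine ⟨fun j => ⟨⟨?_, (hpos j).isHermitian⟩, hrank j⟩, horth⟩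
    -- Idempotence, and thus `a j = 1`, follows from orthogonality and the resolution of the
    -- identity.
    have h1 : A j * ∑ k, A k = A j * A j := by
      rw [Finset.mul_sum]
      exact Finset.sum_eq_single j (fun k _ hk => horth j k hk.symm) (by simp)
    rw [hsum, mul_one] at h1
    exact h1.symm
  · rintro ⟨-, horth⟩
    conv_rhs => rw [← sum_sum_mul_norm_inner_sq hv hA hsum]
    refine Finset.sum_congr rfl fun j _ => Finset.sum_congr rfl fun k _ => ?_
    by_cases hjk : j = k
    · subst hjk
      rw [norm_inner_self_eq_one hv, one_pow]
    · have h1 := congrArg Matrix.trace (horth j k hjk)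
      rw [hA j, hA k, Matrix.smul_mul, Matrix.mul_smul, trace_smul, trace_smul,
        trace_vecMulVec_star_mul, trace_zero, smul_eq_mul, smul_eq_mul, ← Complex.ofReal_mul,
        ← Complex.ofReal_mul, Complex.ofReal_eq_zero] at h1
      have h2 := (mul_eq_zero.mp ((mul_eq_zero.mp h1).resolve_left (ha j).ne')).resolve_left
        (ha k).ne'
      rw [h2, pow_eq_zero_iff two_ne_zero |>.mp h2]

theorem mul_inv_sqrt_sq_and_pos (d : ℕ) :
    ((d : ℝ) + 1) * (Real.sqrt (d + 1))⁻¹ ^ 2 = 1 ∧ 0 < (Real.sqrt ((d : ℝ) + 1))⁻¹ := by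
  refine ⟨?_, by positivity⟩
  rw [inv_pow, Real.sq_sqrt (by positivity), mul_inv_cancel₀ (by positivity)]

omit [Fintype κ] in
theorem quartic_nonneg (ha : ∀ j, 0 < a j) (hv : ∀ j, ‖v j‖ = 1) {t : ℝ} (ht : 0 < t) (j k : κ) :
    0 ≤ a j * a k * ((‖inner ℂ (v j) (v k)‖ - t) ^ 2
      * ((1 - ‖inner ℂ (v j) (v k)‖) * (‖inner ℂ (v j) (v k)‖ + 1 + 2 * t))) := by
  have h1 := sub_nonneg.mpr (norm_inner_le_one hv j k)
  have h2 := norm_nonneg (inner ℂ (v j) (v k))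
  have := ha j
  have := ha k
  positivity

theorem sum_overlaps_le (ha : ∀ j, 0 < a j) (hv : ∀ j, ‖v j‖ = 1)
    (hA : ∀ j, A j = (a j : ℂ) • vecMulVec (v j).ofLp (star (v j).ofLp))
    (hsum : ∑ j, A j = 1) :
    ∑ j, ∑ k, a j * a k * ‖inner ℂ (v j) (v k)‖ ≤ 1 + (d - 1) * Real.sqrt (d + 1) := by
  obtain ⟨ht, ht0⟩ := mul_inv_sqrt_sq_and_pos d
  have h := sum_quartic_eq hv hA hsum ht ht0
  rw [inv_inv] at h
  have hf := two_mul_le_framePotential hv (sum_weights hv hA hsum)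
  have hq := Finset.sum_nonneg fun j (_ : j ∈ Finset.univ) =>
    Finset.sum_nonneg fun k (_ : k ∈ Finset.univ) => quartic_nonneg ha hv ht0 j k
  rw [← sub_nonneg]
  refine nonneg_of_mul_nonneg_right (b := _) (a := 2 * (Real.sqrt (d + 1))⁻¹
    * (1 + (Real.sqrt (d + 1))⁻¹) ^ 2) ?_ (by positivity)
  rw [← h]
  linarith

theorem isSIC_of_sum_overlaps_eq [NeZero d] (ha : ∀ j, 0 < a j) (hv : ∀ j, ‖v j‖ = 1)
    (hA : ∀ j, A j = (a j : ℂ) • vecMulVec (v j).ofLp (star (v j).ofLp))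
    (hsum : ∑ j, A j = 1) (hS : IsSimple A)
    (heq : ∑ j, ∑ k, a j * a k * ‖inner ℂ (v j) (v k)‖ = 1 + (d - 1) * Real.sqrt (d + 1)) :
    IsSIC A := by
  classical
  obtain ⟨ht, ht0⟩ := mul_inv_sqrt_sq_and_pos d
  have h := sum_quartic_eq hv hA hsum ht ht0
  have hd : (d : ℝ) ≠ 0 := by exact_mod_cast NeZero.ne d
  set t := (Real.sqrt ((d : ℝ) + 1))⁻¹ with htdef
  rw [heq, htdef, inv_inv, sub_self, mul_zero, ← htdef] at h
  have hf := two_mul_le_framePotential hv (sum_weights hv hA hsum)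
  have hnn := quartic_nonneg (a := a) ha hv ht0
  have hq := Finset.sum_nonneg fun j (_ : j ∈ Finset.univ) =>
    Finset.sum_nonneg fun k (_ : k ∈ Finset.univ) => hnn j k
  have h0 : ∑ j, ∑ k, a j * a k * ((‖inner ℂ (v j) (v k)‖ - t) ^ 2
      * ((1 - ‖inner ℂ (v j) (v k)‖) * (‖inner ℂ (v j) (v k)‖ + 1 + 2 * t))) = 0 := by linarith
  have hov : ∀ j k, j ≠ k → ‖inner ℂ (v j) (v k)‖ = t := by
    intro j k hjk
    have h1 := (Finset.sum_eq_zero_iff_of_nonneg fun j _ =>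
      Finset.sum_nonneg fun k _ => hnn j k).mp h0 j (Finset.mem_univ _)
    have h2 := (Finset.sum_eq_zero_iff_of_nonneg fun k _ => hnn j k).mp h1 k (Finset.mem_univ _)
    have h3 := (mul_eq_zero.mp h2).resolve_left (mul_pos (ha j) (ha k)).ne'
    have h4 := norm_nonneg (inner ℂ (v j) (v k))
    rcases mul_eq_zero.mp h3 with h5 | h5
    · exact sub_eq_zero.mp (pow_eq_zero_iff two_ne_zero |>.mp h5)
    · rcases mul_eq_zero.mp h5 with h6 | h6
      · exact absurd (sub_eq_zero.mp h6).symm (norm_inner_ne_one_of_isSimple ha hv hA hS hjk)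
      · linarith
  have hsq : ∀ j k, ‖inner ℂ (v j) (v k)‖ ^ 2
      = ((d : ℝ) * (if j = k then 1 else 0) + 1) / ((d : ℝ) + 1) := by
    intro j k
    split_ifs with hjk
    · subst hjk
      rw [norm_inner_self_eq_one hv, one_pow, mul_one, div_self (by positivity)]
    · rw [hov j k hjk, eq_div_iff (by positivity)]
      linear_combination ht
  -- With the overlaps known, `∑ k, a k s² = 1` at `v j` reads `(d a j + d)/(d + 1) = 1`. The number
  -- of outcomes then follows from `∑ a j = d`.
  have hw : ∀ j, a j = (d : ℝ)⁻¹ := by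
    intro j
    have h1 := sum_mul_norm_inner_sq hA hsum (v j)
    have h2 : ∀ k, a k * ‖inner ℂ (v j) (v k)‖ ^ 2
        = (if j = k then a k * d else 0) / (d + 1) + a k / (d + 1) := by
      intro k
      rw [hsq]
      split_ifs <;> ring
    simp only [h2, Finset.sum_add_distrib, ← Finset.sum_div] at h1
    rw [Finset.sum_ite_eq, if_pos (Finset.mem_univ _), sum_weights hv hA hsum, hv] at h1
    have hd1 : (d : ℝ) + 1 ≠ 0 := by positivity
    field_simp at h1 ⊢
    linarith
  refine ⟨?_, fun j => (v j).ofLp, ?_, ?_⟩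
  · have h1 := sum_weights hv hA hsum
    simp only [hw, Finset.sum_const, Finset.card_univ, nsmul_eq_mul] at h1
    field_simp at h1
    exact_mod_cast h1
  · intro j k
    convert hsq j k using 3
    rw [EuclideanSpace.inner_eq_star_dotProduct, dotProduct_comm]
  · intro j
    rw [hA j, hw j]
    push_cast
    rfl

theorem sum_overlaps_eq_of_card [NeZero d] (hcard : Fintype.card κ = d ^ 2)
    (hv : ∀ j, ‖v j‖ = 1) (hov : ∀ j k, j ≠ k → ‖inner ℂ (v j) (v k)‖ = (Real.sqrt (d + 1))⁻¹) :
    ∑ j, ∑ k, (d : ℝ)⁻¹ * (d : ℝ)⁻¹ * ‖inner ℂ (v j) (v k)‖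
      = 1 + (d - 1) * Real.sqrt (d + 1) := by
  classical
  have hd : (d : ℝ) ≠ 0 := by exact_mod_cast NeZero.ne d
  have h : ∀ j k, ‖inner ℂ (v j) (v k)‖
      = (Real.sqrt (d + 1))⁻¹ + if j = k then 1 - (Real.sqrt (d + 1))⁻¹ else 0 := by
    intro j k
    split_ifs with hjk
    · subst hjk
      rw [norm_inner_self_eq_one hv]; ring
    · rw [hov j k hjk, add_zero]
  simp only [h, ← Finset.mul_sum, Finset.sum_add_distrib, Finset.sum_ite_eq, Finset.mem_univ,
    if_true, Finset.sum_const, Finset.card_univ, hcard, nsmul_eq_mul]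
  have hr : Real.sqrt ((d : ℝ) + 1) ^ 2 = d + 1 := Real.sq_sqrt (by positivity)
  have hr0 : Real.sqrt ((d : ℝ) + 1) ≠ 0 := by positivity
  push_cast
  field_simp
  linear_combination (1 - (d : ℝ)) * hr

end Frame

/-- The fidelity formula holds for every rank-one decomposition, so it is applied directly to the
SIC vectors `ψ`, without comparing them to eigenvectors of the `A j`. -/
theorem estimationFidelity_eq_of_isSIC {d : ℕ} [NeZero d] {κ : Type*} [Fintype κ]
    {A : κ → Matrix (Fin d) (Fin d) ℂ} (hsum : ∑ j, A j = 1) (hS : IsSIC A) :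
    estimationFidelity (twoCopy A) = 2 / (d * (d + 1) * (d + 2))
      * (d ^ 2 + d + (1 + (d - 1) * Real.sqrt (d + 1))) := by
  classical
  obtain ⟨hcard, ψ, hψ, hA⟩ := hS
  have hd : 0 < (d : ℝ) := by exact_mod_cast NeZero.pos d
  have hin : ∀ j k, ‖inner ℂ (WithLp.toLp 2 (ψ j) : EuclideanSpace ℂ (Fin d))
      (WithLp.toLp 2 (ψ k))‖ ^ 2
        = ((d : ℝ) * (if j = k then 1 else 0) + 1) / ((d : ℝ) + 1) := by
    intro j k
    convert hψ j k using 3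
    rw [EuclideanSpace.inner_eq_star_dotProduct, dotProduct_comm]
  have hv : ∀ j, ‖(WithLp.toLp 2 (ψ j) : EuclideanSpace ℂ (Fin d))‖ = 1 := by
    intro j
    have h := hin j j
    rw [if_pos rfl, mul_one, div_self (by positivity), inner_self_eq_norm_sq_to_K, norm_pow,
      ← pow_mul, RCLike.norm_ofReal, abs_norm] at h
    exact (pow_eq_one_iff_of_nonneg (norm_nonneg _) (by norm_num)).mp h
  rw [estimationFidelity_eq (a := fun _ => (d : ℝ)⁻¹) (v := fun j => WithLp.toLp 2 (ψ j))
    (fun _ => by positivity) hv (fun j => by rw [hA j]; push_cast; rfl) hsum,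
    sum_overlaps_eq_of_card hcard hv]
  intro j k hjk
  have h := hin j k
  rw [if_neg hjk, mul_zero, zero_add] at h
  rw [← Real.sqrt_inv, ← one_div, ← h, Real.sqrt_sq (norm_nonneg _)]

end QMeas
theorem theorem3 (d : ℕ) [NeZero d] {κ : Type*} [Fintype κ]
    (A : κ → Matrix (Fin d) (Fin d) ℂ) (hA : QMeas.IsPOVM A) (hrank : QMeas.IsRankOne A) :
    (2 / ((d : ℝ) + 1) ≤ QMeas.estimationFidelity (QMeas.twoCopy A) ∧
      QMeas.estimationFidelity (QMeas.twoCopy A) ≤ QMeas.F2iid d) ∧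
    (QMeas.IsSimple A →
      (QMeas.estimationFidelity (QMeas.twoCopy A) = 2 / ((d : ℝ) + 1) ↔
        QMeas.IsRankOneProjective A) ∧
      (QMeas.estimationFidelity (QMeas.twoCopy A) = QMeas.F2iid d ↔ QMeas.IsSIC A)) := by
  obtain ⟨hpos, hsum⟩ := hA
  choose a ha v hv hAv using fun j =>
    QMeas.PosSemidef.eq_smul_vecMulVec_of_rank_eq_one (hpos j) (hrank j)
  have hd : 0 < (d : ℝ) := by exact_mod_cast NeZero.pos d
  have hC : 0 < 2 / ((d : ℝ) * (d + 1) * (d + 2)) := by positivity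
  have hF := QMeas.estimationFidelity_eq ha hv hAv hsum
  -- Both bounds are put in the form of the fidelity formula, with overlap sums `d` and `1 + (d -
  -- 1)√(d + 1)`.
  have hlow : 2 / ((d : ℝ) + 1) = 2 / ((d : ℝ) * (d + 1) * (d + 2)) * (d ^ 2 + d + d) := by
    field_simp
    ring
  have hupp : QMeas.F2iid d = 2 / ((d : ℝ) * (d + 1) * (d + 2))
      * (d ^ 2 + d + (1 + (d - 1) * Real.sqrt (d + 1))) := by
    rw [QMeas.F2iid]
    ring
  refine ⟨⟨?_, ?_⟩, fun hS => ⟨?_, ?_, ?_⟩⟩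
  · rw [hF, hlow]
    gcongr
    exact QMeas.le_sum_overlaps ha hv hAv hsum
  · rw [hF, hupp]
    gcongr
    exact QMeas.sum_overlaps_le ha hv hAv hsum
  · rw [hF, hlow, ← QMeas.sum_overlaps_eq_iff_isRankOneProjective ha hv hAv hsum hpos hrank hS,
      mul_right_inj' hC.ne', add_right_inj]
  · intro h
    rw [hF, hupp, mul_right_inj' hC.ne', add_right_inj] at h
    exact QMeas.isSIC_of_sum_overlaps_eq ha hv hAv hsum hS h
  · intro h
    rw [hupp, QMeas.estimationFidelity_eq_of_isSIC hsum h]
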